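/- Let $\mathcal A$ be a real or complex Banach algebra with identity. For a ring $R$ with identity, call $x\in R$ quasinilpotent if $1+xy$ is invertible for every $y\in R$ with $xy=yx$ (in a Banach algebra this means $\lim_{n\to\infty}\|x^n\|^{1/n}=0$). An element $a\in R$ is g-Drazin invertible if there is $a^d\in R$ (necessarily unique, called the g-Drazin inverse of $a$) with $a^d=a^daa^d$, $aa^d=a^da$ and $a-a^2a^d$ quasinilpotent; then $a^\pi:=1-aa^d$. Matrices below are elements of the ring $M_2(\mathcal A)$. **Theorem 2.2.** Let $a,b\in\mathcal A$ be such that $a$, $b$ and $b^\pi a$ are g-Drazin invertible, and suppose $b^\pi ab^d=0$. Then the following are equivalent: 1. $M=\begin{pmatrix}a&1\\ b&0\end{pmatrix}$ is g-Drazin invertible; 2. $N=\begin{pmatrix}b^\pi a&1\\ b^\pi b&0\end{pmatrix}$ is g-Drazin invertible; 3. $\begin{pmatrix}ab^\pi&1\\ bb^\pi&0\end{pmatrix}$ is g-Drazin invertible. Moreover, suppose $N$ is g-Drazin invertible, and put $$\alpha=\begin{pmatrix}bb^dabb^d&bb^d\\ b^2b^d&0\end{pmatrix},\qquad S=\begin{pmatrix}bb^dab^\pi+b^\pi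 a&b^\pi\\ bb^\pi&0\end{pmatrix}.$$ Then $\alpha$ has the group inverse (that is, $\alpha\alpha^\#\alpha=\alpha$, $\alpha^\#\alpha\alpha^\#=\alpha^\#$, $\alpha\alpha^\#=\alpha^\#\alpha$) $$\alpha^\#=\begin{pmatrix}0&b^d\\ bb^d&-bb^dab^d\end{pmatrix},\qquad \alpha^\pi:=1-\alpha\alpha^\#=\begin{pmatrix}b^\pi&0\\ 0&b^\pi\end{pmatrix};$$ $S$ is g-Drazin invertible with $$S^d=\begin{pmatrix}bb^da+b^\pi a&1\\ b&0\end{pmatrix}N^d\begin{pmatrix}1&0\\ 0&b^\pi\end{pmatrix}N^d\begin{pmatrix}b^\pi&0\\ 0&b^\pi\end{pmatrix};$$ and $$M^d=\alpha^\pi S^d+\sum_{i=0}^{\infty}(\alpha^\#)^{i+1}S^iS^\pi,$$ where the series converges unconditionally in $M_2(\mathcal A)$ (with the product topology of $\mathcal A^4$). -/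

import Mathlib

/-- An element `a` of a ring (with identity) is quasinilpotent if `1 + a x` is invertible for every
`x` commuting with `a`. -/
def GDQuasinilpotent {R : Type*} [Ring R] (a : R) : Prop :=
  ∀ x : R, a * x = x * a → IsUnit (1 + a * x)

/-- `c` is the g-Drazin inverse `a^d` of `a`: `c = c a c`, `a c = c a` and `a - a² c` is
quasinilpotent. -/
structure IsGDrazinInverse {R : Type*} [Ring R] (a c : R) : Prop where
  outer : c = c * a * c
  comm : a * c = c * a
  quasinilpotent : GDQuasinilpotent (a - a ^ 2 * c)

/-- `a` is g-Drazin invertible, that is `a ∈ R^d`. -/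
def GDrazinInvertible {R : Type*} [Ring R] (a : R) : Prop :=
  ∃ c : R, IsGDrazinInverse a c

/-- The spectral idempotent `a^π = 1 - a a^d`, where `ad` is the g-Drazin inverse of `a`. -/
def spectralIdem {R : Type*} [Ring R] (a ad : R) : R := 1 - a * ad

/-- `c` is the group inverse `a^#` of `a`. -/
structure IsGroupInverse {R : Type*} [Ring R] (a c : R) : Prop where
  inner : a * c * a = a
  outer : c * a * c = c
  comm : a * c = c * a

open Filter Topology Asymptotics

/-!
Put `E = b b^d` and `P = b^π`, as scalar matrices. Then `M = M E + M P = α + S`, where `α` has the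
group inverse `α^#` with `α α^# = E`, and `S α = 0`.

If `S^d` exists, the series `T = ∑ (α^#)^(i+1) S^i S^π` solves `T = α^# S^π + α^# T S` and
`T S^d = 0`, and these two equations alone make `P S^d + T` the g-Drazin inverse of `α + S`.
Conversely, let `M` be g-Drazin invertible. Then `X = M^π α^#` satisfies `X = q X α^#` for the
quasinilpotent `q = M M^π`, and iterating this relation gives `X = 0`. Hence `P M^d` is a g-Drazin
inverse of the corner `P M = P S`, and Cline's formula passes from `P S` to `S P = S`. Cline's
formula also relates `S = M P` to the other two matrices of the equivalence.

Both the convergence of the series and `X = 0` rest on the powers of a quasinilpotent element being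
dominated by every geometric sequence. This is Gelfand's formula, which needs complex scalars; they
are obtained by letting the algebra act on its complex-valued real-linear functionals.
-/

section

variable {R : Type*} [Ring R] {a c x y : R}

theorem isUnit_one_add_mul_comm : IsUnit (1 + x * y) ↔ IsUnit (1 + y * x) := by
  simpa only [spectrum.mem_iff, not_iff_not, Units.val_neg, Units.val_one, map_neg, map_one,
    ← neg_add', IsUnit.neg_iff] using
    spectrum.unit_mem_mul_comm (R := ℤ) (a := x) (b := y) (r := -1)

theorem commute_mul_mul_mul {z : R} (hz : Commute (y * x) z) : Commute (x * y) (x * z * y) :=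
  calc x * y * (x * z * y) = x * (y * x * z) * y := by simp only [mul_assoc]
    _ = x * z * y * (x * y) := by rw [hz.eq]; simp only [mul_assoc]

theorem GDQuasinilpotent.mul_comm (h : GDQuasinilpotent (x * y)) : GDQuasinilpotent (y * x) := by
  intro z hz
  have hz2 : Commute (x * y) (x * z ^ 2 * y) := commute_mul_mul_mul (Commute.pow_right hz 2)
  have hsq : x * z * y * (x * z * y) = x * y * (x * z ^ 2 * y) :=
    calc x * z * y * (x * z * y) = x * z * (y * x * z) * y := by simp only [mul_assoc]
      _ = x * z ^ 2 * y * (x * y) := by rw [hz, pow_two]; simp only [mul_assoc]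
      _ = x * y * (x * z ^ 2 * y) := hz2.eq.symm
  have hfactor : (1 + x * z * y) * (1 - x * z * y) = 1 + x * y * -(x * z ^ 2 * y) := by
    rw [mul_neg, ← hsq]; noncomm_ring
  have hunit := h _ hz2.neg_right
  rw [← hfactor, Commute.isUnit_mul_iff] at hunit
  · rw [mul_assoc, isUnit_one_add_mul_comm]
    exact hunit.1
  · exact (Commute.one_left _).add_left ((Commute.one_right _).sub_right (Commute.refl _))

namespace IsGDrazinInverse

theorem inv_mul_inv_mul_self (h : IsGDrazinInverse a c) : c * c * a = c := by
  rw [mul_assoc, ← h.comm, ← mul_assoc, ← h.outer]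

theorem self_mul_inv_mul_inv (h : IsGDrazinInverse a c) : a * c * c = c := by
  rw [h.comm, ← h.outer]

theorem spectralIdem_mul_inv (h : IsGDrazinInverse a c) : spectralIdem a c * c = 0 := by
  rw [spectralIdem, sub_mul, one_mul, h.self_mul_inv_mul_inv, sub_self]

theorem inv_mul_spectralIdem (h : IsGDrazinInverse a c) : c * spectralIdem a c = 0 := by
  rw [spectralIdem, mul_sub, mul_one, ← mul_assoc, ← h.outer, sub_self]

theorem commute_spectralIdem (h : IsGDrazinInverse a c) : Commute a (spectralIdem a c) :=
  (Commute.one_right a).sub_right ((Commute.refl a).mul_right h.comm)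

theorem isIdempotentElem_spectralIdem (h : IsGDrazinInverse a c) :
    IsIdempotentElem (spectralIdem a c) := by
  have := h.inv_mul_spectralIdem
  nth_rw 1 [IsIdempotentElem, spectralIdem, sub_mul, one_mul, mul_assoc, this, mul_zero, sub_zero]

theorem quasinilpotent_mul_spectralIdem (h : IsGDrazinInverse a c) :
    GDQuasinilpotent (a * spectralIdem a c) := by
  have := h.quasinilpotent
  rwa [pow_two, mul_assoc, ← mul_one_sub] at this

theorem cline (h : IsGDrazinInverse (x * y) c) : IsGDrazinInverse (y * x) (y * c ^ 2 * x) where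
  outer := by
    have hinv : c ^ 2 * (x * y) * (x * y) * c ^ 2 = c ^ 2 := by
      rw [pow_two, h.inv_mul_inv_mul_self, ← mul_assoc, ← h.outer]
    calc y * c ^ 2 * x = y * (c ^ 2 * (x * y) * (x * y) * c ^ 2) * x := by rw [hinv]
      _ = y * c ^ 2 * x * (y * x) * (y * c ^ 2 * x) := by simp only [mul_assoc]
  comm :=
    calc y * x * (y * c ^ 2 * x) = y * (x * y * c ^ 2) * x := by simp only [mul_assoc]
      _ = y * (c ^ 2 * (x * y)) * x := by rw [(Commute.pow_right h.comm 2).eq]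
      _ = y * c ^ 2 * x * (y * x) := by simp only [mul_assoc]
  quasinilpotent := by
    have hresidual : y * x - (y * x) ^ 2 * (y * c ^ 2 * x) = y * (spectralIdem (x * y) c * x) :=
      calc y * x - (y * x) ^ 2 * (y * c ^ 2 * x)
          = y * x - y * (x * y) * (x * y * c * c) * x := by simp only [pow_two, mul_assoc]
        _ = y * (spectralIdem (x * y) c * x) := by
          rw [h.self_mul_inv_mul_inv, spectralIdem]; noncomm_ring
    rw [hresidual]
    refine GDQuasinilpotent.mul_comm ?_
    rw [mul_assoc, ← h.commute_spectralIdem.eq]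
    exact h.quasinilpotent_mul_spectralIdem

theorem corner {M D P : R} (h : IsGDrazinInverse M D) (hM : P * M * P = P * M)
    (hD : P * D * P = P * D) (hP : spectralIdem M D * P = spectralIdem M D) :
    IsGDrazinInverse (P * M) (P * D) where
  outer := by
    calc P * D = P * (D * M * D) := by rw [← h.outer]
      _ = P * D * P * M * D := by rw [hD]; simp only [mul_assoc]
      _ = P * D * (P * M * P) * D := by rw [hM]; simp only [mul_assoc]
      _ = P * D * (P * M) * (P * D) := by simp only [mul_assoc]
  comm := by
    rw [← mul_assoc, hM, ← mul_assoc, hD, mul_assoc, h.comm, mul_assoc]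
  quasinilpotent := by
    have hresidual : P * M - (P * M) ^ 2 * (P * D) = P * (M * spectralIdem M D) :=
      calc P * M - (P * M) ^ 2 * (P * D) = P * M - P * M * (P * M * P) * D := by
            simp only [pow_two, mul_assoc]
        _ = P * M - P * M * M * D := by rw [hM, ← mul_assoc (P * M) P, hM]
        _ = P * (M * spectralIdem M D) := by rw [spectralIdem]; noncomm_ring
    rw [hresidual]
    refine GDQuasinilpotent.mul_comm ?_
    rw [mul_assoc, hP]
    exact h.quasinilpotent_mul_spectralIdem

end IsGDrazinInverse

theorem gDrazinInvertible_mul_comm : GDrazinInvertible (x * y) ↔ GDrazinInvertible (y * x) :=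
  ⟨fun ⟨_, h⟩ => ⟨_, h.cline⟩, fun ⟨_, h⟩ => ⟨_, h.cline⟩⟩

variable {α α' S s T : R}

theorem IsGroupInverse.spectralIdem_mul (hα : IsGroupInverse α α') : spectralIdem α α' * α = 0 := by
  rw [spectralIdem, sub_mul, one_mul, hα.inner, sub_self]

theorem IsGroupInverse.mul_spectralIdem (hα : IsGroupInverse α α') : α * spectralIdem α α' = 0 := by
  rw [spectralIdem, hα.comm, mul_sub, mul_one, ← mul_assoc, hα.inner, sub_self]

theorem IsGroupInverse.mul_inv_mul_inv (hα : IsGroupInverse α α') : α * α' * α' = α' := by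
  rw [hα.comm, hα.outer]

theorem IsGroupInverse.spectralIdem_mul_inv (hα : IsGroupInverse α α') :
    spectralIdem α α' * α' = 0 := by
  rw [spectralIdem, sub_mul, one_mul, hα.mul_inv_mul_inv, sub_self]

theorem IsGroupInverse.mul_inv_eq_zero (hα : IsGroupInverse α α') (h : S * α = 0) : S * α' = 0 := by
  rw [← hα.mul_inv_mul_inv, ← mul_assoc, ← mul_assoc, h, zero_mul, zero_mul]

theorem IsGDrazinInverse.inv_mul_eq_zero (hS : IsGDrazinInverse S s) (h : S * x = 0) :
    s * x = 0 := by
  rw [← hS.inv_mul_inv_mul_self, mul_assoc, h, mul_zero]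

/-- The properties of the series `∑ (α')^(i+1) S^i S^π` that are needed for the g-Drazin
inverse of `α + S`, stated without convergence: `T` solves a Sylvester equation and annihilates the
g-Drazin inverse `s` of `S`. -/
structure IsSylvesterSolution (α' S s T : R) : Prop where
  eq : T = α' * spectralIdem S s + α' * T * S
  mul_inv : T * s = 0

namespace IsSylvesterSolution

theorem mul_inv_mul (hT : IsSylvesterSolution α' S s T) (hα : IsGroupInverse α α') :
    α * α' * T = T := by
  rw [hT.eq, mul_add]
  simp only [← mul_assoc, hα.mul_inv_mul_inv]

theorem mul_self (hT : IsSylvesterSolution α' S s T) (hα : IsGroupInverse α α') :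
    α * T = α * α' * spectralIdem S s + T * S := by
  nth_rw 1 [hT.eq]
  rw [mul_add, ← mul_assoc, ← mul_assoc, ← mul_assoc, hT.mul_inv_mul hα]

theorem self_mul (hT : IsSylvesterSolution α' S s T) (hα : IsGroupInverse α α')
    (hSα : S * α = 0) (hsα : s * α = 0) : T * α = α * α' := by
  have hwα : spectralIdem S s * α = α := by
    rw [spectralIdem, sub_mul, one_mul, mul_assoc, hsα, mul_zero, sub_zero]
  rw [hT.eq, add_mul, mul_assoc _ S, hSα, mul_zero, add_zero, mul_assoc, hwα, hα.comm]

theorem self_mul_spectralIdem (hT : IsSylvesterSolution α' S s T) (hS : IsGDrazinInverse S s) :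
    T * spectralIdem S s = T := by
  rw [spectralIdem, hS.comm, mul_sub, mul_one, ← mul_assoc, hT.mul_inv, zero_mul, sub_zero]

theorem residual_add (hT : IsSylvesterSolution α' S s T) (hα : IsGroupInverse α α')
    (hS : IsGDrazinInverse S s) (hSα : S * α = 0) :
    α + S - (α + S) * (S * s + α * T) = (1 - α * T) * (S * spectralIdem S s) := by
  have hααT : α * (α * T) = α * spectralIdem S s + α * (T * S) := by
    rw [hT.mul_self hα, mul_add, ← mul_assoc, hα.comm, ← mul_assoc, hα.inner]
  have hTSw : T * (S * spectralIdem S s) = T * S := by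
    rw [hS.commute_spectralIdem.eq, ← mul_assoc, hT.self_mul_spectralIdem hS]
  rw [sub_mul, mul_assoc, hTSw, add_mul, mul_add, mul_add, hααT, ← mul_assoc S α, hSα,
    spectralIdem]
  noncomm_ring

theorem isGDrazinInverse_add (hT : IsSylvesterSolution α' S s T) (hα : IsGroupInverse α α')
    (hS : IsGDrazinInverse S s) (hSα : S * α = 0) :
    IsGDrazinInverse (α + S) (spectralIdem α α' * s + T) := by
  have hsα : s * α = 0 := hS.inv_mul_eq_zero hSα
  have hST : S * T = 0 := by
    rw [← hT.mul_inv_mul hα, ← mul_assoc, ← mul_assoc, hSα, zero_mul, zero_mul]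
  have hTSs : T * (S * s) = 0 := by rw [hS.comm, ← mul_assoc, hT.mul_inv, zero_mul]
  have hright : (α + S) * (spectralIdem α α' * s + T) = S * s + α * T := by
    have hSπ : S * spectralIdem α α' = S := by
      rw [spectralIdem, mul_sub, ← mul_assoc, hSα, zero_mul, sub_zero, mul_one]
    rw [add_mul, mul_add, mul_add, ← mul_assoc, ← mul_assoc, hα.mul_spectralIdem, hSπ, hST]
    noncomm_ring
  have hleft : (spectralIdem α α' * s + T) * (α + S) = S * s + α * T := by
    rw [add_mul, mul_add, mul_add, mul_assoc, mul_assoc, hsα, hT.self_mul hα hSα hsα,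
      hT.mul_self hα, ← hS.comm, spectralIdem, spectralIdem]
    noncomm_ring
  refine ⟨?_, hright.trans hleft.symm, ?_⟩
  · have hsSs : s * (S * s) = s := by rw [← mul_assoc, ← hS.outer]
    rw [mul_assoc, hright, add_mul, mul_add, mul_add, mul_assoc, mul_assoc, hsSs, ← mul_assoc s,
      hsα, hTSs, ← mul_assoc T, hT.self_mul hα hSα hsα, hT.mul_inv_mul hα, zero_mul, mul_zero,
      zero_add, add_zero]
  · have hSwα : S * spectralIdem S s * α = 0 := by
      rw [hS.commute_spectralIdem.eq, mul_assoc, hSα, mul_zero]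
    rw [pow_two, mul_assoc, hright, hT.residual_add hα hS hSα]
    refine GDQuasinilpotent.mul_comm ?_
    rw [mul_sub, mul_one, ← mul_assoc, hSwα, zero_mul, sub_zero]
    exact hS.quasinilpotent_mul_spectralIdem

end IsSylvesterSolution

theorem IsGDrazinInverse.pow_mul_spectralIdem (hS : IsGDrazinInverse S s) (n : ℕ) :
    S ^ n * spectralIdem S s = (S * spectralIdem S s) ^ n * spectralIdem S s := by
  rw [hS.commute_spectralIdem.mul_pow, mul_assoc, ← pow_succ,
    hS.isIdempotentElem_spectralIdem.pow_succ_eq]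

theorem isSylvesterSolution_of_hasSum [TopologicalSpace R] [IsTopologicalRing R] [T2Space R]
    (hS : IsGDrazinInverse S s)
    (hT : HasSum (fun i : ℕ => α' ^ (i + 1) * S ^ i * spectralIdem S s) T) :
    IsSylvesterSolution α' S s T where
  eq := by
    have hshift := (hasSum_nat_add_iff' 1).2 hT
    have hterm : ∀ i : ℕ, α' ^ (i + 1 + 1) * S ^ (i + 1) * spectralIdem S s =
        α' * (α' ^ (i + 1) * S ^ i * spectralIdem S s) * S := fun i => by
      rw [pow_succ' α', pow_succ S, mul_assoc, mul_assoc, mul_assoc, hS.commute_spectralIdem.eq]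
      simp only [mul_assoc]
    simp only [hterm, Finset.sum_range_one, zero_add, pow_one, pow_zero, mul_one] at hshift
    rw [← sub_eq_iff_eq_add']
    exact hshift.unique ((hT.mul_left α').mul_right S)
  mul_inv := by
    have hzero := hT.mul_right s
    simp only [mul_assoc, hS.spectralIdem_mul_inv, mul_zero] at hzero
    exact hzero.unique hasSum_zero

theorem IsGroupInverse.mul_spectralIdem_of_mul_eq_zero (hα : IsGroupInverse α α')
    (h : x * α' = 0) : x * spectralIdem α α' = x := by
  rw [spectralIdem, hα.comm, mul_sub, mul_one, ← mul_assoc, h, zero_mul, sub_zero]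

theorem GDrazinInvertible.of_add {D : R} (hD : IsGDrazinInverse (α + S) D)
    (hα : IsGroupInverse α α') (hSα : S * α = 0)
    (hπ : spectralIdem (α + S) D * α' = 0) : GDrazinInvertible S := by
  have hSα' : S * α' = 0 := hα.mul_inv_eq_zero hSα
  have hPadd : spectralIdem α α' * (α + S) = spectralIdem α α' * S := by
    rw [mul_add, hα.spectralIdem_mul, zero_add]
  have hDα : D * α = α' * α := by
    have hDMα' : D * (α + S) * α' = α' := by
      rwa [spectralIdem, sub_mul, one_mul, sub_eq_zero, eq_comm, hD.comm] at hπ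
    rw [mul_assoc, add_mul, hSα', add_zero] at hDMα'
    rw [← hDMα', mul_assoc, hα.inner]
  have hcorner : IsGDrazinInverse (spectralIdem α α' * (α + S)) (spectralIdem α α' * D) := by
    refine hD.corner ?_ ?_ (hα.mul_spectralIdem_of_mul_eq_zero hπ)
    · rw [hPadd, mul_assoc, hα.mul_spectralIdem_of_mul_eq_zero hSα']
    · refine hα.mul_spectralIdem_of_mul_eq_zero ?_
      calc spectralIdem α α' * D * α' = spectralIdem α α' * (D * α * α' * α') := by
            rw [mul_assoc, mul_assoc D, mul_assoc D, hα.mul_inv_mul_inv]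
        _ = 0 := by rw [hDα, hα.outer, ← mul_assoc, hα.spectralIdem_mul_inv, zero_mul]
  rw [hPadd] at hcorner
  rw [← hα.mul_spectralIdem_of_mul_eq_zero hSα', gDrazinInvertible_mul_comm]
  exact ⟨_, hcorner⟩

theorem spectralIdem_add_mul_eq {D : R} (hD : IsGDrazinInverse (α + S) D)
    (hα : IsGroupInverse α α') (hSα : S * α = 0) :
    spectralIdem (α + S) D * α' =
      (α + S) * spectralIdem (α + S) D * (spectralIdem (α + S) D * α') * α' := by
  have hMα' : (α + S) * α' * α' = α' := by
    rw [add_mul, hα.mul_inv_eq_zero hSα, add_zero, hα.mul_inv_mul_inv]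
  nth_rw 1 [← hMα']
  rw [← mul_assoc, ← mul_assoc, ← hD.commute_spectralIdem.eq, ← mul_assoc]
  nth_rw 1 [← hD.isIdempotentElem_spectralIdem]
  rw [← mul_assoc]

end

/-- An element whose powers are dominated by every geometric sequence; equivalently
`‖x ^ n‖ ^ (1 / n)` tends to `0`. -/
def TopologicallyQuasinilpotent {B : Type*} [NormedRing B] (x : B) : Prop :=
  ∀ r : ℝ, 0 < r → (fun n : ℕ => x ^ n) =O[atTop] fun n => r ^ n

theorem topologicallyQuasinilpotent_of_spectrum_subset {B : Type*} [NormedRing B]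
    [NormedAlgebra ℂ B] [CompleteSpace B] {x : B} (hx : spectrum ℂ x ⊆ {0}) :
    TopologicallyQuasinilpotent x := by
  intro r hr
  have hradius : spectralRadius ℂ x = 0 := by
    simpa [spectralRadius] using fun z hz => hx hz
  have hroot : Tendsto (fun n : ℕ => ‖x ^ n‖ ^ (1 / n : ℝ)) atTop (𝓝 0) := by
    have := (ENNReal.tendsto_toReal ENNReal.zero_ne_top).comp
      (hradius ▸ spectrum.pow_norm_pow_one_div_tendsto_nhds_spectralRadius x)
    refine this.congr fun n => ENNReal.toReal_ofReal (by positivity)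
  refine IsBigO.of_bound' ?_
  filter_upwards [hroot.eventually_le_const hr, eventually_ne_atTop 0] with n hn hn0
  calc ‖x ^ n‖ = (‖x ^ n‖ ^ (1 / n : ℝ)) ^ n := by
        rw [one_div, Real.rpow_inv_natCast_pow (norm_nonneg _) hn0]
    _ ≤ r ^ n := by gcongr
    _ ≤ ‖r ^ n‖ := le_abs_self _

section

variable {B : Type*} [NormedRing B] [NormedAlgebra ℝ B]

variable (B) in
/-- The complex Banach algebra of operators on the complex-valued real-linear functionals of a real
normed algebra `B`. It serves in place of the complexification, which carries no canonical norm. A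
`def` rather than an `abbrev`, so that instance search stops at the instances below. -/
def DualEnd : Type _ := (B →L[ℝ] ℂ) →L[ℂ] (B →L[ℝ] ℂ)

noncomputable instance : NormedRing (DualEnd B) :=
  inferInstanceAs (NormedRing ((B →L[ℝ] ℂ) →L[ℂ] (B →L[ℝ] ℂ)))

noncomputable instance : NormedAlgebra ℂ (DualEnd B) :=
  inferInstanceAs (NormedAlgebra ℂ ((B →L[ℝ] ℂ) →L[ℂ] (B →L[ℝ] ℂ)))

instance : CompleteSpace (DualEnd B) :=
  inferInstanceAs (CompleteSpace ((B →L[ℝ] ℂ) →L[ℂ] (B →L[ℝ] ℂ)))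

/-- The operator `f ↦ f (· * x)` on functionals. -/
noncomputable def precompMulRight (x : B) : (B →L[ℝ] ℂ) →L[ℂ] (B →L[ℝ] ℂ) :=
  LinearMap.mkContinuous
    { toFun := fun f => f ∘L (ContinuousLinearMap.mul ℝ B).flip x
      map_add' := fun _ _ => rfl
      map_smul' := fun _ _ => rfl }
    ‖(ContinuousLinearMap.mul ℝ B).flip x‖
    fun _ => (ContinuousLinearMap.opNorm_comp_le _ _).trans_eq (mul_comm _ _)

theorem precompMulRight_apply (x : B) (f : B →L[ℝ] ℂ) (y : B) :
    precompMulRight x f y = f (y * x) := rfl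

theorem norm_le_norm_precompMulRight (x : B) : ‖x‖ ≤ ‖(1 : B)‖ * ‖precompMulRight x‖ := by
  obtain ⟨g, hg, hgx⟩ := exists_dual_vector'' ℝ x
  let f : B →L[ℝ] ℂ := Complex.ofRealCLM ∘L g
  have hf : ‖f‖ ≤ 1 := by
    refine (ContinuousLinearMap.opNorm_comp_le _ _).trans ?_
    simpa using hg
  calc ‖x‖ = ‖precompMulRight x f 1‖ := by simp [precompMulRight_apply, f, hgx]
    _ ≤ ‖precompMulRight x‖ * ‖f‖ * ‖(1 : B)‖ :=
      (ContinuousLinearMap.le_opNorm _ _).trans (by gcongr; exact ContinuousLinearMap.le_opNorm _ _)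
    _ ≤ ‖precompMulRight x‖ * 1 * ‖(1 : B)‖ := by gcongr
    _ = _ := by ring

/-- The representation of `B` by precomposition with right multiplications, which brings real
algebras into the scope of Gelfand's formula. -/
noncomputable def dualRep : B →+* DualEnd B where
  toFun := precompMulRight
  map_one' := ContinuousLinearMap.ext fun f => ContinuousLinearMap.ext fun y =>
    congrArg f (mul_one y)
  map_mul' x y := ContinuousLinearMap.ext fun f => ContinuousLinearMap.ext fun z =>
    congrArg f (mul_assoc z x y).symm
  map_zero' := ContinuousLinearMap.ext fun f => ContinuousLinearMap.ext fun y =>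
    (congrArg f (mul_zero y)).trans f.map_zero
  map_add' x y := ContinuousLinearMap.ext fun f => ContinuousLinearMap.ext fun z =>
    (congrArg f (mul_add z x y)).trans (f.map_add _ _)

theorem dualRep_smul (r : ℝ) (x : B) : dualRep (r • x) = (r : ℂ) • dualRep x :=
  ContinuousLinearMap.ext fun f => ContinuousLinearMap.ext fun y =>
    (congrArg f (mul_smul_comm r y x)).trans (f.map_smul r (y * x))

end

section

variable {R C : Type*} [Ring R] [Algebra ℝ R] [NormedRing C] [NormedAlgebra ℂ C] {x : R}

theorem GDQuasinilpotent.isUnit_one_sub_smul_map (hx : GDQuasinilpotent x) (φ : R →+* C)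
    (hφ : ∀ (r : ℝ) (y : R), φ (r • y) = (r : ℂ) • φ y) (z : ℂ) : IsUnit (1 - z • φ x) := by
  have hunit : IsUnit (1 + x * (Complex.normSq z • x - (2 * z.re) • 1)) :=
    hx _ (by simp [mul_sub, sub_mul])
  have hfactor : (1 - z • φ x) * (1 - star z • φ x) =
      φ (1 + x * (Complex.normSq z • x - (2 * z.re) • 1)) :=
    calc (1 - z • φ x) * (1 - star z • φ x)
        = 1 + ((z * star z) • (φ x * φ x) - (z + star z) • φ x) := by
          simp only [mul_sub, sub_mul, mul_one, one_mul, mul_smul_comm, smul_mul_assoc, smul_sub,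
            smul_smul, add_smul, _root_.mul_comm (star z)]
          abel
      _ = 1 + ((Complex.normSq z : ℂ) • (φ x * φ x) - ((2 * z.re : ℝ) : ℂ) • φ x) := by
          rw [← Complex.mul_conj, ← Complex.add_conj]; rfl
      _ = _ := by
          simp only [map_add, map_one, map_mul, map_sub, hφ, mul_sub, mul_smul_comm, mul_one]
  have hcomm : Commute (1 - z • φ x) (1 - star z • φ x) :=
    (Commute.one_left _).sub_left
      ((Commute.one_right _).sub_right (((Commute.refl _).smul_left _).smul_right _))
  exact (hcomm.isUnit_mul_iff.1 (hfactor ▸ hunit.map φ)).1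

theorem GDQuasinilpotent.spectrum_map_subset (hx : GDQuasinilpotent x) (φ : R →+* C)
    (hφ : ∀ (r : ℝ) (y : R), φ (r • y) = (r : ℂ) • φ y) : spectrum ℂ (φ x) ⊆ {0} := by
  intro z hz
  by_contra hz0
  have hfactor : algebraMap ℂ C z - φ x = algebraMap ℂ C z * (1 - z⁻¹ • φ x) := by
    rw [← Algebra.smul_def, smul_sub, smul_inv_smul₀ hz0, Algebra.algebraMap_eq_smul_one]
  refine hz (?_ : IsUnit (algebraMap ℂ C z - φ x))
  rw [hfactor]
  exact ((IsUnit.mk0 z hz0).map (algebraMap ℂ C)).mul (hx.isUnit_one_sub_smul_map φ hφ z⁻¹)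

end

theorem GDQuasinilpotent.topologicallyQuasinilpotent {B : Type*} [NormedRing B]
    [NormedAlgebra ℝ B] {x : B} (hx : GDQuasinilpotent x) : TopologicallyQuasinilpotent x := by
  have hrep : TopologicallyQuasinilpotent (dualRep x) :=
    topologicallyQuasinilpotent_of_spectrum_subset (hx.spectrum_map_subset dualRep dualRep_smul)
  intro r hr
  refine (isBigO_of_le' (c := ‖(1 : B)‖) _ fun n => ?_).trans (hrep r hr)
  rw [← map_pow]
  exact norm_le_norm_precompMulRight (x ^ n)

section

variable {B : Type*} [NormedRing B]

theorem TopologicallyQuasinilpotent.isBigO_norm_pow_mul_norm_pow {q : B}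
    (hq : TopologicallyQuasinilpotent q) (y : B) {r : ℝ} (hr : 0 < r) :
    (fun n : ℕ => ‖y ^ n‖ * ‖q ^ n‖) =O[atTop] fun n => r ^ n := by
  have hy : 0 < ‖y‖ + 1 := by positivity
  have hypow : (fun n : ℕ => ‖y ^ n‖) =O[atTop] fun n => (‖y‖ + 1) ^ n := by
    refine IsBigO.of_bound' ?_
    filter_upwards [eventually_gt_atTop 0] with n hn
    rw [norm_norm, Real.norm_of_nonneg (by positivity)]
    exact (norm_pow_le' y hn).trans (by gcongr; linarith)
  refine (hypow.mul (hq (r / (‖y‖ + 1)) (by positivity)).norm_left).congr_right fun n => ?_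
  rw [← mul_pow, mul_div_cancel₀ _ hy.ne']

theorem TopologicallyQuasinilpotent.eq_zero_of_eq_mul_mul {q X y : B}
    (hq : TopologicallyQuasinilpotent q) (hX : X = q * X * y) : X = 0 := by
  have hiter : ∀ n : ℕ, X = q ^ n * X * y ^ n := fun n => by
    induction n with
    | zero => simp
    | succ n ih =>
      rw [pow_succ, pow_succ']
      nth_rw 1 [ih, hX]
      simp only [mul_assoc]
  have hbound : (fun _ : ℕ => X) =O[atTop] fun n : ℕ => ‖y ^ n‖ * ‖q ^ n‖ := by
    refine IsBigO.of_bound ‖X‖ (Eventually.of_forall fun n => ?_)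
    calc ‖X‖ = ‖q ^ n * X * y ^ n‖ := by rw [← hiter]
      _ ≤ ‖q ^ n‖ * ‖X‖ * ‖y ^ n‖ := norm_mul₃_le
      _ = ‖X‖ * ‖‖y ^ n‖ * ‖q ^ n‖‖ := by rw [Real.norm_of_nonneg (by positivity)]; ring
  have hlim : Tendsto (fun n : ℕ => ((1 : ℝ) / 2) ^ n) atTop (𝓝 0) :=
    tendsto_pow_atTop_nhds_zero_of_lt_one (by norm_num) (by norm_num)
  exact tendsto_const_nhds_iff.1
    ((hbound.trans (hq.isBigO_norm_pow_mul_norm_pow y one_half_pos)).trans_tendsto hlim)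

variable [NormedAlgebra ℝ B]

theorem summable_pow_mul_pow_mul_spectralIdem [CompleteSpace B] {S s : B}
    (hS : IsGDrazinInverse S s) (y : B) :
    Summable fun i : ℕ => y ^ (i + 1) * S ^ i * spectralIdem S s := by
  have hq := hS.quasinilpotent_mul_spectralIdem.topologicallyQuasinilpotent
  refine summable_of_isBigO_nat summable_geometric_two (IsBigO.trans ?_
    (hq.isBigO_norm_pow_mul_norm_pow y one_half_pos))
  refine IsBigO.of_bound (‖y‖ * ‖spectralIdem S s‖) (Eventually.of_forall fun i => ?_)
  rw [mul_assoc, hS.pow_mul_spectralIdem, pow_succ', mul_assoc]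
  calc ‖y * (y ^ i * ((S * spectralIdem S s) ^ i * spectralIdem S s))‖
      ≤ ‖y‖ * (‖y ^ i‖ * (‖(S * spectralIdem S s) ^ i‖ * ‖spectralIdem S s‖)) := by
        refine norm_mul_le_of_le le_rfl (norm_mul_le_of_le le_rfl (norm_mul_le _ _))
    _ = _ := by rw [Real.norm_of_nonneg (by positivity)]; ring

theorem gDrazinInvertible_add_iff [CompleteSpace B] {α α' S : B} (hα : IsGroupInverse α α')
    (hSα : S * α = 0) : GDrazinInvertible (α + S) ↔ GDrazinInvertible S := by
  refine ⟨fun ⟨D, hD⟩ => .of_add hD hα hSα ?_, fun ⟨s, hs⟩ => ?_⟩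
  · exact hD.quasinilpotent_mul_spectralIdem.topologicallyQuasinilpotent.eq_zero_of_eq_mul_mul
      (spectralIdem_add_mul_eq hD hα hSα)
  · have hT := isSylvesterSolution_of_hasSum hs (summable_pow_mul_pow_mul_spectralIdem hs α').hasSum
    exact ⟨_, hT.isGDrazinInverse_add hα hs hSα⟩

end

section

variable {A : Type*} [NormedRing A] [CompleteSpace A] {n : Type*} [Fintype n] [DecidableEq n]

attribute [local instance] Matrix.linftyOpNormedRing Matrix.linftyOpNormedAlgebra

theorem completeSpace_matrix_linftyOp :
    @CompleteSpace (Matrix n n A) NonUnitalSeminormedRing.toPseudoMetricSpace.toUniformSpace :=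
  inferInstanceAs (@CompleteSpace (Matrix n n A) (Matrix.instUniformSpace _ _ _))

variable [NormedAlgebra ℝ A]

theorem gDrazinInvertible_matrix_add_iff {α α' S : Matrix n n A} (hα : IsGroupInverse α α')
    (hSα : S * α = 0) : GDrazinInvertible (α + S) ↔ GDrazinInvertible S :=
  have := completeSpace_matrix_linftyOp (n := n) (A := A)
  gDrazinInvertible_add_iff hα hSα

theorem summable_matrix_pow_mul_pow_mul_spectralIdem {S s : Matrix n n A}
    (hS : IsGDrazinInverse S s) (y : Matrix n n A) :
    Summable fun i : ℕ => y ^ (i + 1) * S ^ i * spectralIdem S s :=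
  have := completeSpace_matrix_linftyOp (n := n) (A := A)
  summable_pow_mul_pow_mul_spectralIdem hS y

end

section

variable {R : Type*} [Ring R] {E M N P Q α' Nd : R}

theorem isGroupInverse_mul (hEα' : E * α' = α') (hMα' : M * α' = E) (hα'M : α' * (M * E) = E) :
    IsGroupInverse (M * E) α' where
  inner := by rw [mul_assoc M E α', hEα', mul_assoc, hα'M]
  outer := by rw [hα'M, hEα']
  comm := by rw [hα'M, mul_assoc, hEα', hMα']

theorem gDrazinInvertible_mul_iff (hPM : P * M = N * Q) (hQN : Q * N = N) :
    GDrazinInvertible (M * P) ↔ GDrazinInvertible N := by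
  rw [gDrazinInvertible_mul_comm, hPM, gDrazinInvertible_mul_comm, hQN]

theorem IsGDrazinInverse.mul_of_eq (hN : IsGDrazinInverse N Nd) (hPM : P * M = N * Q)
    (hQN : Q * N = N) (hQP : Q * P = P) : IsGDrazinInverse (M * P) (M * Nd * Q * Nd * P) := by
  have hNQ : IsGDrazinInverse (N * Q) (N * Nd ^ 2 * Q) := by
    rw [← hQN] at hN
    simpa only [hQN] using hN.cline
  have hNNd : N * Nd ^ 2 = Nd := by rw [pow_two, ← mul_assoc, hN.self_mul_inv_mul_inv]
  rw [← hPM, hNNd] at hNQ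
  have hformula : M * (Nd * Q) ^ 2 * P = M * Nd * Q * Nd * P := by
    simp only [pow_two, mul_assoc, hQP]
  exact hformula ▸ hNQ.cline

end

section

variable {R : Type*} [Ring R] {a b bd : R}

theorem IsGDrazinInverse.self_mul_inv_mul_self_mul_inv (hb : IsGDrazinInverse b bd) :
    b * bd * (b * bd) = b * bd := by
  rw [mul_assoc, ← mul_assoc bd, ← hb.outer]

theorem self_mul_inv_add_spectralIdem : b * bd + spectralIdem b bd = 1 :=
  add_sub_cancel _ _

theorem mul_eq_of_spectralIdem_mul_mul_eq_zero {x : R} (h : spectralIdem b bd * a * x = 0) :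
    a * x = b * bd * a * x := by
  rwa [spectralIdem, sub_mul, sub_mul, one_mul, sub_eq_zero] at h

theorem IsGDrazinInverse.mul_self_mul_inv (hb : IsGDrazinInverse b bd)
    (h : spectralIdem b bd * a * bd = 0) : a * (b * bd) = b * bd * a * b * bd :=
  calc a * (b * bd) = a * bd * b := by rw [hb.comm, mul_assoc]
    _ = b * bd * a * (bd * b) := by rw [mul_eq_of_spectralIdem_mul_mul_eq_zero h, mul_assoc]
    _ = b * bd * a * b * bd := by rw [← hb.comm, mul_assoc (b * bd * a)]

theorem IsGDrazinInverse.spectralIdem_mul_mul_spectralIdem (hb : IsGDrazinInverse b bd)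
    (h : spectralIdem b bd * a * bd = 0) :
    spectralIdem b bd * a * spectralIdem b bd = spectralIdem b bd * a := by
  nth_rw 2 [spectralIdem]
  rw [hb.comm, mul_sub, mul_one, ← mul_assoc, h, zero_mul, sub_zero]

/-- The common shape of the three matrices of the theorem: `M` itself, `N` with `b^π a` and `b^π b`,
and the third one with `a b^π` and `b b^π` in place of `a` and `b`. -/
abbrev antiTriangular (a b : R) : Matrix (Fin 2) (Fin 2) R := !![a, 1; b, 0]

/-- The scalar matrix with diagonal entry `x`. -/
abbrev diagTwo (x : R) : Matrix (Fin 2) (Fin 2) R := !![x, 0; 0, x]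

/-- The matrix `α` of the theorem: the part of `M` on the range of `b b^d`. -/
abbrev corePart (a b bd : R) : Matrix (Fin 2) (Fin 2) R :=
  !![b * bd * a * b * bd, b * bd; b ^ 2 * bd, 0]

/-- The matrix `α^#` of the theorem. -/
abbrev corePartInv (a b bd : R) : Matrix (Fin 2) (Fin 2) R :=
  !![0, bd; b * bd, -(b * bd * a * bd)]

/-- The matrix `S` of the theorem: the part of `M` on the range of `b^π`. -/
abbrev reducedPart (a b bd : R) : Matrix (Fin 2) (Fin 2) R :=
  !![b * bd * a * spectralIdem b bd + spectralIdem b bd * a, spectralIdem b bd;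
    b * spectralIdem b bd, 0]

theorem diagTwo_mul_inv_add_diagTwo_spectralIdem :
    diagTwo (b * bd) + diagTwo (spectralIdem b bd) = 1 := by
  simp [Matrix.one_fin_two, self_mul_inv_add_spectralIdem]

theorem one_sub_diagTwo : 1 - diagTwo (b * bd) = diagTwo (spectralIdem b bd) :=
  sub_eq_of_eq_add' diagTwo_mul_inv_add_diagTwo_spectralIdem.symm

theorem antiTriangular_mul_diagTwo_mul_inv (hb : IsGDrazinInverse b bd)
    (h : spectralIdem b bd * a * bd = 0) :
    antiTriangular a b * diagTwo (b * bd) = corePart a b bd := by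
  have hbb : b * (b * bd) = b ^ 2 * bd := by rw [pow_two, mul_assoc]
  simp only [Matrix.mul_fin_two, hb.mul_self_mul_inv h, hbb, mul_zero, zero_mul, add_zero,
    zero_add, one_mul, corePart]

theorem antiTriangular_mul_diagTwo_spectralIdem (hb : IsGDrazinInverse b bd)
    (h : spectralIdem b bd * a * bd = 0) :
    antiTriangular a b * diagTwo (spectralIdem b bd) = reducedPart a b bd := by
  have hap : a * spectralIdem b bd = b * bd * a * spectralIdem b bd + spectralIdem b bd * a := by
    rw [← hb.spectralIdem_mul_mul_spectralIdem h, ← add_mul, ← add_mul,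
      self_mul_inv_add_spectralIdem, one_mul]
  simp only [Matrix.mul_fin_two, hap, mul_zero, zero_mul, add_zero, zero_add, one_mul]

theorem antiTriangular_mul_corePartInv (h : spectralIdem b bd * a * bd = 0) :
    antiTriangular a b * corePartInv a b bd = diagTwo (b * bd) := by
  simp only [Matrix.mul_fin_two, mul_eq_of_spectralIdem_mul_mul_eq_zero h, mul_zero, zero_mul,
    add_zero, zero_add, one_mul, add_neg_cancel]

theorem diagTwo_mul_corePartInv (hb : IsGDrazinInverse b bd) :
    diagTwo (b * bd) * corePartInv a b bd = corePartInv a b bd := by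
  have hea : b * bd * (b * bd * a * bd) = b * bd * a * bd := by
    rw [← mul_assoc, ← mul_assoc, hb.self_mul_inv_mul_self_mul_inv]
  simp only [Matrix.mul_fin_two, mul_zero, zero_mul, add_zero, zero_add, mul_neg, neg_zero, hea,
    hb.self_mul_inv_mul_inv, hb.self_mul_inv_mul_self_mul_inv, corePartInv]

theorem corePartInv_mul_corePart (hb : IsGDrazinInverse b bd) :
    corePartInv a b bd * corePart a b bd = diagTwo (b * bd) := by
  have he := hb.self_mul_inv_mul_self_mul_inv
  have hbb : bd * (b ^ 2 * bd) = b * bd := by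
    rw [pow_two, mul_assoc, ← mul_assoc bd, ← hb.comm, he]
  have haa : b * bd * (b * bd * a * b * bd) = b * bd * a * bd * (b ^ 2 * bd) :=
    calc b * bd * (b * bd * a * b * bd) = b * bd * (b * bd) * a * (b * bd) := by
          simp only [mul_assoc]
      _ = b * bd * a * bd * (b ^ 2 * bd) := by rw [he, mul_assoc _ bd (b ^ 2 * bd), hbb]
  simp only [Matrix.mul_fin_two, mul_zero, zero_mul, add_zero, zero_add, neg_mul, haa, hbb, he,
    add_neg_cancel]

theorem isGroupInverse_corePart (hb : IsGDrazinInverse b bd)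
    (h : spectralIdem b bd * a * bd = 0) :
    IsGroupInverse (corePart a b bd) (corePartInv a b bd) := by
  have hcore := corePartInv_mul_corePart (a := a) hb
  rw [← antiTriangular_mul_diagTwo_mul_inv hb h] at hcore ⊢
  exact isGroupInverse_mul (diagTwo_mul_corePartInv hb) (antiTriangular_mul_corePartInv h) hcore

theorem spectralIdem_corePart (hb : IsGDrazinInverse b bd)
    (h : spectralIdem b bd * a * bd = 0) :
    spectralIdem (corePart a b bd) (corePartInv a b bd) = diagTwo (spectralIdem b bd) := by
  rw [← one_sub_diagTwo, spectralIdem, (isGroupInverse_corePart hb h).comm,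
    corePartInv_mul_corePart hb]

theorem corePart_add_reducedPart (hb : IsGDrazinInverse b bd)
    (h : spectralIdem b bd * a * bd = 0) :
    corePart a b bd + reducedPart a b bd = antiTriangular a b := by
  rw [← antiTriangular_mul_diagTwo_mul_inv hb h, ← antiTriangular_mul_diagTwo_spectralIdem hb h,
    ← mul_add, diagTwo_mul_inv_add_diagTwo_spectralIdem, mul_one]

theorem reducedPart_mul_corePart (hb : IsGDrazinInverse b bd)
    (h : spectralIdem b bd * a * bd = 0) : reducedPart a b bd * corePart a b bd = 0 := by
  rw [← antiTriangular_mul_diagTwo_spectralIdem hb h, ← spectralIdem_corePart hb h, mul_assoc,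
    (isGroupInverse_corePart hb h).spectralIdem_mul, mul_zero]

theorem diagTwo_spectralIdem_mul_antiTriangular :
    diagTwo (spectralIdem b bd) * antiTriangular a b =
      antiTriangular (spectralIdem b bd * a) (spectralIdem b bd * b) *
        !![1, 0; 0, spectralIdem b bd] := by
  simp

theorem diag_one_spectralIdem_mul_antiTriangular (hb : IsGDrazinInverse b bd) :
    !![1, 0; 0, spectralIdem b bd] *
      antiTriangular (spectralIdem b bd * a) (spectralIdem b bd * b) =
        antiTriangular (spectralIdem b bd * a) (spectralIdem b bd * b) := by
  simp [← mul_assoc, hb.isIdempotentElem_spectralIdem.eq]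

theorem gDrazinInvertible_reducedPart_iff_left (hb : IsGDrazinInverse b bd)
    (h : spectralIdem b bd * a * bd = 0) :
    GDrazinInvertible (reducedPart a b bd) ↔
      GDrazinInvertible (antiTriangular (spectralIdem b bd * a) (spectralIdem b bd * b)) := by
  rw [← antiTriangular_mul_diagTwo_spectralIdem hb h]
  exact gDrazinInvertible_mul_iff diagTwo_spectralIdem_mul_antiTriangular
    (diag_one_spectralIdem_mul_antiTriangular hb)

theorem gDrazinInvertible_reducedPart_iff_right (hb : IsGDrazinInverse b bd)
    (h : spectralIdem b bd * a * bd = 0) :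
    GDrazinInvertible (reducedPart a b bd) ↔
      GDrazinInvertible (antiTriangular (a * spectralIdem b bd) (b * spectralIdem b bd)) := by
  have hright : antiTriangular (a * spectralIdem b bd) (b * spectralIdem b bd) *
      !![1, 0; 0, spectralIdem b bd] = reducedPart a b bd := by
    rw [← antiTriangular_mul_diagTwo_spectralIdem hb h]
    simp
  have hleft : !![1, 0; 0, spectralIdem b bd] *
      antiTriangular (a * spectralIdem b bd) (b * spectralIdem b bd) =
        antiTriangular (a * spectralIdem b bd) (b * spectralIdem b bd) := by
    simp [hb.commute_spectralIdem.eq, ← mul_assoc,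
      hb.isIdempotentElem_spectralIdem.eq]
  rw [← hright, gDrazinInvertible_mul_comm, hleft]

theorem isGDrazinInverse_reducedPart (hb : IsGDrazinInverse b bd)
    (h : spectralIdem b bd * a * bd = 0) {Nd : Matrix (Fin 2) (Fin 2) R}
    (hN : IsGDrazinInverse
      (antiTriangular (spectralIdem b bd * a) (spectralIdem b bd * b)) Nd) :
    IsGDrazinInverse (reducedPart a b bd)
      (antiTriangular (b * bd * a + spectralIdem b bd * a) b * Nd * !![1, 0; 0, spectralIdem b bd] *
        Nd * diagTwo (spectralIdem b bd)) := by
  have hQP : !![1, 0; 0, spectralIdem b bd] * diagTwo (spectralIdem b bd) =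
      diagTwo (spectralIdem b bd) := by
    simp [hb.isIdempotentElem_spectralIdem.eq]
  rw [← add_mul, self_mul_inv_add_spectralIdem, one_mul,
    ← antiTriangular_mul_diagTwo_spectralIdem hb h]
  exact hN.mul_of_eq diagTwo_spectralIdem_mul_antiTriangular
    (diag_one_spectralIdem_mul_antiTriangular hb) hQP

end

theorem theorem2p2_general {A : Type*} [NormedRing A] [NormedAlgebra ℝ A] [CompleteSpace A]
    (a b bd : A)
    (hb : IsGDrazinInverse b bd)
    (h : spectralIdem b bd * a * bd = 0) :
    List.TFAE
      [GDrazinInvertible !![a, 1; b, 0],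
       GDrazinInvertible !![spectralIdem b bd * a, 1; spectralIdem b bd * b, 0],
       GDrazinInvertible !![a * spectralIdem b bd, 1; b * spectralIdem b bd, 0]] ∧
    ∀ Nd : Matrix (Fin 2) (Fin 2) A,
      IsGDrazinInverse !![spectralIdem b bd * a, 1; spectralIdem b bd * b, 0] Nd →
      let p : A := spectralIdem b bd
      let α : Matrix (Fin 2) (Fin 2) A := !![b * bd * a * b * bd, b * bd; b ^ 2 * bd, 0]
      let α' : Matrix (Fin 2) (Fin 2) A := !![0, bd; b * bd, -(b * bd * a * bd)]
      let S : Matrix (Fin 2) (Fin 2) A := !![b * bd * a * p + p * a, p; b * p, 0]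
      let Sd : Matrix (Fin 2) (Fin 2) A :=
        !![b * bd * a + p * a, 1; b, 0] * Nd * !![1, 0; 0, p] * Nd * !![p, 0; 0, p]
      IsGroupInverse α α' ∧
      spectralIdem α α' = !![p, 0; 0, p] ∧
      IsGDrazinInverse S Sd ∧
      ∃ T : Matrix (Fin 2) (Fin 2) A,
        HasSum (fun i : ℕ => α' ^ (i + 1) * S ^ i * spectralIdem S Sd) T ∧
        IsGDrazinInverse !![a, 1; b, 0] (spectralIdem α α' * Sd + T) := by
  have hadd := corePart_add_reducedPart hb h
  have hα := isGroupInverse_corePart hb h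
  have hSα := reducedPart_mul_corePart hb h
  have hMS : GDrazinInvertible (antiTriangular a b) ↔ GDrazinInvertible (reducedPart a b bd) := by
    rw [← hadd]
    exact gDrazinInvertible_matrix_add_iff hα hSα
  refine ⟨?_, fun Nd hN => ?_⟩
  · tfae_have 1 ↔ 2 := hMS.trans (gDrazinInvertible_reducedPart_iff_left hb h)
    tfae_have 1 ↔ 3 := hMS.trans (gDrazinInvertible_reducedPart_iff_right hb h)
    tfae_finish
  · intro p α α' S Sd
    have hS : IsGDrazinInverse S Sd := isGDrazinInverse_reducedPart hb h hN
    have hT := (summable_matrix_pow_mul_pow_mul_spectralIdem hS α').hasSum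
    refine ⟨hα, spectralIdem_corePart hb h, hS, _, hT, ?_⟩
    have hM := (isSylvesterSolution_of_hasSum hS hT).isGDrazinInverse_add hα hS hSα
    rwa [hadd] at hM

theorem theorem2p2 {𝕜 : Type*} [RCLike 𝕜] {A : Type*} [NormedRing A] [NormedAlgebra 𝕜 A]
    [CompleteSpace A] (a b bd : A)
    (ha : GDrazinInvertible a) (hb : IsGDrazinInverse b bd)
    (hba : GDrazinInvertible (spectralIdem b bd * a))
    (h : spectralIdem b bd * a * bd = 0) :
    List.TFAE
      [GDrazinInvertible !![a, 1; b, 0],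
       GDrazinInvertible !![spectralIdem b bd * a, 1; spectralIdem b bd * b, 0],
       GDrazinInvertible !![a * spectralIdem b bd, 1; b * spectralIdem b bd, 0]] ∧
    ∀ Nd : Matrix (Fin 2) (Fin 2) A,
      IsGDrazinInverse !![spectralIdem b bd * a, 1; spectralIdem b bd * b, 0] Nd →
      let p : A := spectralIdem b bd
      let α : Matrix (Fin 2) (Fin 2) A := !![b * bd * a * b * bd, b * bd; b ^ 2 * bd, 0]
      let α' : Matrix (Fin 2) (Fin 2) A := !![0, bd; b * bd, -(b * bd * a * bd)]
      let S : Matrix (Fin 2) (Fin 2) A := !![b * bd * a * p + p * a, p; b * p, 0]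
      let Sd : Matrix (Fin 2) (Fin 2) A :=
        !![b * bd * a + p * a, 1; b, 0] * Nd * !![1, 0; 0, p] * Nd * !![p, 0; 0, p]
      IsGroupInverse α α' ∧
      spectralIdem α α' = !![p, 0; 0, p] ∧
      IsGDrazinInverse S Sd ∧
      ∃ T : Matrix (Fin 2) (Fin 2) A,
        HasSum (fun i : ℕ => α' ^ (i + 1) * S ^ i * spectralIdem S Sd) T ∧
        IsGDrazinInverse !![a, 1; b, 0] (spectralIdem α α' * Sd + T) := by
  let _ : NormedAlgebra ℝ A := NormedAlgebra.restrictScalars ℝ 𝕜 A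
  exact theorem2p2_general a b bd hb h
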